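/- Let $q$ be a formal variable. For formal power series $a,b\in\mathbb{Q}[[q]]$, where $b$ has zero constant term, put $(a;b)_\infty=\prod_{j\ge 0}(1-ab^j)$, and for integers $n\ge 0$ put $(a;b)_n=\prod_{0\le j<n}(1-ab^j)$; write $(a_1,a_2,a_3;b)_\infty=(a_1;b)_\infty(a_2;b)_\infty(a_3;b)_\infty$, and for integers $0\le k\le n$ let ${n\brack k}_q=\frac{(q;q)_n}{(q;q)_k(q;q)_{n-k}}$. For an integer $k\ge 1$ let $$S_k(q)=\sum_{n\ge k}\frac{q^{\binom{k}{2}+(k+1)n}}{(q;q)_n}{n-1\brack k-1}_q .$$ 1. For every integer $k\ge 1$, all coefficients of the power series $(q^2,q^3,q^5;q^5)_\infty\,S_k(q)$ are nonnegative. 2. For every integer $k\ge 2$, all coefficients of the power series $(q,q^4,q^5;q^5)_\infty\,S_k(q)$ are nonnegative. 3. The coefficients of $q^7$ and of $q^{13}$ in $(q,q^4,q^5;q^5)_\infty\,S_1(q)$ are equal to $-1$, and all its other coefficients are nonnegative. -/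

import Mathlib

open PowerSeries
open scoped PowerSeries.WithPiTopology

noncomputable section

/-- The infinite `q`-shifted factorial `(a; q)_∞ = ∏_{j ≥ 0} (1 - a q ^ j)` of formal power
series; the product converges coefficientwise whenever `q` has constant coefficient `0`, see
`multipliable_qShiftedInf`. -/
def qShiftedInf (a q : ℚ⟦X⟧) : ℚ⟦X⟧ := ∏' j : ℕ, (1 - a * q ^ j)

/-- The finite `q`-shifted factorial `(a; q)_n = ∏_{0 ≤ j < n} (1 - a q ^ j)`; see
`qShifted_mul_qShiftedInf` for its description as `(a; q)_∞ / (a q ^ n; q)_∞`. -/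
def qShifted (a q : ℚ⟦X⟧) (n : ℕ) : ℚ⟦X⟧ := ∏ j ∈ Finset.range n, (1 - a * q ^ j)

/-- The `q`-binomial coefficient `(q; q)_n / ((q; q)_k (q; q)_{n - k})` in the formal variable
`q = X`, which is `0` for `k > n`. -/
def qBinom (n k : ℕ) : ℚ⟦X⟧ :=
  if k ≤ n then qShifted X X n * (qShifted X X k * qShifted X X (n - k))⁻¹ else 0

/-- The summand `q ^ (C(k, 2) + (k + 1) n) / (q; q)_n * [n - 1 choose k - 1]_q`
(used for `1 ≤ k ≤ n`). -/
def truncTerm (k n : ℕ) : ℚ⟦X⟧ :=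
  X ^ (k.choose 2 + (k + 1) * n) * (qShifted X X n)⁻¹ * qBinom (n - 1) (k - 1)

/-- The series `∑_{n ≥ k} q ^ (C(k, 2) + (k + 1) n) / (q; q)_n * [n - 1 choose k - 1]_q`. -/
def truncSeries (k : ℕ) : ℚ⟦X⟧ := ∑' n : Set.Ici k, truncTerm k n

theorem multipliable_qShiftedInf (a q : ℚ⟦X⟧) (hq : constantCoeff q = 0) :
    Multipliable fun j : ℕ => 1 - a * q ^ j := by
  simp_rw [sub_eq_add_neg]
  apply PowerSeries.WithPiTopology.multipliable_one_add_of_tendsto_order_atTop_nhds_top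
  refine ENat.tendsto_nhds_top_iff_natCast_lt.mpr fun n =>
    Filter.eventually_atTop.mpr ⟨n + 1, fun m hm => ?_⟩
  have h1 : (X : ℚ⟦X⟧) ^ m ∣ -(a * q ^ m) :=
    (Dvd.dvd.mul_left (pow_dvd_pow_of_dvd (X_dvd_iff.mpr hq) m) a).neg_right
  have h2 : (m : ℕ∞) ≤ (-(a * q ^ m)).order :=
    le_order _ _ fun i hi => (X_pow_dvd_iff.mp h1) i (by exact_mod_cast hi)
  exact lt_of_lt_of_le (by exact_mod_cast hm) h2

theorem qShifted_mul_qShiftedInf (a q : ℚ⟦X⟧) (hq : constantCoeff q = 0) (n : ℕ) :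
    qShifted a q n * qShiftedInf (a * q ^ n) q = qShiftedInf a q := by
  have h := multipliable_qShiftedInf (a * q ^ n) q hq
  have e : (fun j : ℕ => 1 - a * q ^ n * q ^ j) = fun j => 1 - a * q ^ (j + n) := by
    funext j; ring
  unfold qShifted qShiftedInf
  rw [e] at h ⊢
  exact Multipliable.prod_mul_tprod_nat_mul' (f := fun j : ℕ => 1 - a * q ^ j) h

theorem summable_truncTerm (k : ℕ) : Summable fun n : Set.Ici k => truncTerm k n := by
  rw [PowerSeries.WithPiTopology.summable_iff_summable_coeff]
  intro d
  refine summable_of_hasFiniteSupport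
    (((Set.finite_Iic d).preimage Subtype.val_injective.injOn).subset fun n hn => ?_)
  by_contra hnd
  have hlt : d < (n : ℕ) := by simpa using hnd
  have hdvd : (X : ℚ⟦X⟧) ^ (k.choose 2 + (k + 1) * (n : ℕ)) ∣ truncTerm k n :=
    Dvd.intro _ (mul_assoc _ _ _).symm
  exact hn (X_pow_dvd_iff.mp hdvd d (by nlinarith [Nat.zero_le (k.choose 2), Nat.zero_le (k * n)]))

end

/-!
Write `t_j = X ^ (j * (3 * j + 1) / 2) * (1 - X ^ (2 * j + 1))`. Pascal's rule for the `q`-binomial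
coefficients and Euler's identity `∑ z ^ m / (X; X)_m = 1 / (z; X)_∞` give
`(X; X)_∞ * (S_k + S_{k+1}) = t_k`, hence `(X; X)_∞ * S_k = t_k - t_{k+1} + t_{k+2} - ⋯`. The two
products of the theorem are `(X; X)_∞` without the factors `1 - X ^ p` with `p ≡ 1, 4`, respectively
`p ≡ 2, 3`, modulo `5`. So the coefficients in question are those of the alternating series, divided
by all `1 - X ^ p` with `p` in these classes.

Divided by `(1 - X) ^ 2`, the alternating series has a piecewise linear coefficient sequence: hills
of increasing size, followed by valleys of depth `2`, `4`, `6`, …. Cutting it at the zeros before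
the hills yields summands, each a hill followed by a smaller valley, which are up to a power of `X`
`pairTerm κ i = (1 - X ^ u) * (1 - X ^ v) - X ^ (u + v) * (1 - X ^ a) * (1 - X ^ b)`
with `κ = k - 1`, `u > a` and `v ≥ b` (`exists_qShiftedInf_mul_truncSeries`). Every single summand
turns out to have nonnegative coefficients after the division, except that `pairTerm 0 0` has the
coefficients `-1` of `X ^ 5` and `X ^ 11` in the case of the parts `2, 3` modulo `5`; this summand
is multiplied by `X ^ 2`, which gives the exponents `7` and `13`.

No asymptotic information is needed for this. By `1 - X ^ (m + n) = (1 - X ^ m) + X ^ m (1 - X ^ n)`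
the quotient of `1 - X ^ n` by `∏ p ∈ P, (1 - X ^ p)` is nonnegative as soon as `n` lies in the
semigroup generated by `P`, and such factors can be multiplied if their sets `P` are disjoint
(`PosOver`). Since `pairTerm κ i` decomposes into products of two and three factors `1 - X ^ n`
(`pairTerm_eq`, `pairTerm_eq'`, `pairTerm_eq_of_add_eq`), only the semigroup membership of a few
linear forms in `κ` and `i` has to be checked. This fails for eight small pairs `(κ, i)`, for which
explicit polynomial certificates are given, and for `κ = 0` with the parts `2, 3` modulo `5`, where
the negative term of `1 - X` has to be compensated (`one_sub_X_add_posOver`) and where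
`pairTerm 0 0` is treated by the table `firstCoeffs` of coefficients together with a growth bound.
-/

/-! ### Quotients by products of factors `1 - X ^ p` -/

/-- All coefficients of the power series are nonnegative. -/
def CoeffNonneg (f : ℚ⟦X⟧) : Prop := ∀ n, 0 ≤ coeff n f

namespace CoeffNonneg

variable {f g : ℚ⟦X⟧}

theorem add (hf : CoeffNonneg f) (hg : CoeffNonneg g) : CoeffNonneg (f + g) := fun n => by
  rw [map_add]; exact add_nonneg (hf n) (hg n)

theorem mul (hf : CoeffNonneg f) (hg : CoeffNonneg g) : CoeffNonneg (f * g) := fun n => by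
  rw [coeff_mul]; exact Finset.sum_nonneg fun x _ => mul_nonneg (hf x.1) (hg x.2)

theorem zero : CoeffNonneg 0 := fun n => by simp

theorem X_pow (m : ℕ) : CoeffNonneg (X ^ m) := fun n => by
  rw [coeff_X_pow]; split_ifs <;> norm_num

theorem one : CoeffNonneg 1 := by simpa using X_pow 0

theorem prod {ι : Type*} (s : Finset ι) {f : ι → ℚ⟦X⟧} (h : ∀ i ∈ s, CoeffNonneg (f i)) :
    CoeffNonneg (∏ i ∈ s, f i) :=
  Finset.prod_induction f CoeffNonneg (fun _ _ => mul) one h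

end CoeffNonneg

theorem one_sub_X_pow_mul_inv {p : ℕ} (hp : p ≠ 0) :
    (1 - X ^ p : ℚ⟦X⟧) * (1 - X ^ p)⁻¹ = 1 :=
  PowerSeries.mul_inv_cancel _ (by simp [hp])

/-- The recursion for the coefficients of a quotient by `1 - X ^ p`. -/
theorem coeff_mul_inv_one_sub_X_pow {p : ℕ} (hp : p ≠ 0) (f : ℚ⟦X⟧) (n : ℕ) :
    coeff n (f * (1 - X ^ p)⁻¹) =
      coeff n f + if p ≤ n then coeff (n - p) (f * (1 - X ^ p)⁻¹) else 0 := by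
  have h : f * (1 - X ^ p)⁻¹ = f + f * (1 - X ^ p)⁻¹ * X ^ p := by
    linear_combination f * one_sub_X_pow_mul_inv hp
  conv_lhs => rw [h]
  rw [map_add, coeff_mul_X_pow']

theorem coeffNonneg_inv_one_sub_X_pow (p : ℕ) : CoeffNonneg (1 - X ^ p : ℚ⟦X⟧)⁻¹ := by
  rcases eq_or_ne p 0 with rfl | hp
  · simpa using CoeffNonneg.zero
  intro n
  induction n using Nat.strong_induction_on with
  | _ n ih =>
    have h := coeff_mul_inv_one_sub_X_pow hp 1 n
    rw [one_mul] at h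
    rw [h]
    refine add_nonneg (CoeffNonneg.one n) ?_
    split_ifs with hn
    · exact ih _ (by omega)
    · exact le_rfl

/-- The generating function of the partitions into parts taken from `P`. -/
noncomputable def partGen (P : Finset ℕ) : ℚ⟦X⟧ := ∏ p ∈ P, (1 - X ^ p)⁻¹

theorem coeffNonneg_partGen (P : Finset ℕ) : CoeffNonneg (partGen P) :=
  CoeffNonneg.prod P fun p _ => coeffNonneg_inv_one_sub_X_pow p

theorem partGen_union {P Q : Finset ℕ} (h : Disjoint P Q) :
    partGen (P ∪ Q) = partGen P * partGen Q := Finset.prod_union h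

theorem prod_mul_partGen {P : Finset ℕ} (h : 0 ∉ P) :
    (∏ p ∈ P, (1 - X ^ p : ℚ⟦X⟧)) * partGen P = 1 := by
  rw [partGen, ← Finset.prod_mul_distrib]
  exact Finset.prod_eq_one fun p hp => one_sub_X_pow_mul_inv (by rintro rfl; exact h hp)

/-- The quotient of `f` by `∏ p ∈ P, (1 - X ^ p)` has nonnegative coefficients. -/
def PosOver (P : Finset ℕ) (f : ℚ⟦X⟧) : Prop := CoeffNonneg (f * partGen P)

namespace PosOver

variable {P Q : Finset ℕ} {f g : ℚ⟦X⟧}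

theorem of_coeffNonneg (P : Finset ℕ) (hf : CoeffNonneg f) : PosOver P f :=
  hf.mul (coeffNonneg_partGen P)

theorem X_pow (P : Finset ℕ) (n : ℕ) : PosOver P (X ^ n) := of_coeffNonneg P (.X_pow n)

theorem add (hf : PosOver P f) (hg : PosOver P g) : PosOver P (f + g) := by
  unfold PosOver; rw [add_mul]; exact CoeffNonneg.add hf hg

theorem X_pow_mul (n : ℕ) (hf : PosOver P f) : PosOver P (X ^ n * f) := by
  unfold PosOver; rw [mul_assoc]; exact (CoeffNonneg.X_pow n).mul hf

theorem mono (h : P ⊆ Q) (hf : PosOver P f) : PosOver Q f := by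
  have : f * partGen Q = f * partGen P * partGen (Q \ P) := by
    rw [mul_assoc, ← partGen_union Finset.disjoint_sdiff, Finset.union_sdiff_of_subset h]
  unfold PosOver
  rw [this]
  exact CoeffNonneg.mul hf (coeffNonneg_partGen _)

theorem mul_union (h : Disjoint P Q) (hf : PosOver P f) (hg : PosOver Q g) :
    PosOver (P ∪ Q) (f * g) := by
  unfold PosOver
  rw [partGen_union h, mul_mul_mul_comm]
  exact CoeffNonneg.mul hf hg

/-- Factors that are controlled by disjoint sets of parts can be multiplied. -/
theorem mul {R : Finset ℕ} (hf : PosOver P f) (hg : PosOver Q g)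
    (h : Disjoint P Q := by decide) (hR : P ∪ Q ⊆ R := by decide) : PosOver R (f * g) :=
  (mul_union h hf hg).mono hR

theorem one_sub_X_pow_of_mem {p : ℕ} (h : p ∈ P) : PosOver P (1 - X ^ p) := by
  rcases eq_or_ne p 0 with rfl | hp
  · simpa using of_coeffNonneg P CoeffNonneg.zero
  refine mono (Finset.singleton_subset_iff.mpr h) ?_
  rw [PosOver, partGen, Finset.prod_singleton, one_sub_X_pow_mul_inv hp]
  exact .one

/-- `1 - X ^ (m + n) = (1 - X ^ m) + X ^ m * (1 - X ^ n)`, so the exponents `n` for which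
`1 - X ^ n` is positive over `P` form a monoid. -/
theorem one_sub_X_pow_add {m n : ℕ} (hm : PosOver P (1 - X ^ m)) (hn : PosOver P (1 - X ^ n)) :
    PosOver P (1 - X ^ (m + n)) := by
  have : (1 - X ^ (m + n) : ℚ⟦X⟧) = (1 - X ^ m) + X ^ m * (1 - X ^ n) := by ring
  rw [this]
  exact hm.add (hn.X_pow_mul m)

theorem one_sub_X_pow_mul {m : ℕ} (hm : PosOver P (1 - X ^ m)) (s : ℕ) :
    PosOver P (1 - X ^ (m * s)) := by
  induction s with
  | zero => simpa using of_coeffNonneg P CoeffNonneg.zero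
  | succ s ih => rw [Nat.mul_succ]; exact one_sub_X_pow_add ih hm

/-- Nonnegative combinations of two parts are admissible exponents. -/
theorem one_sub_X_pow_of_eq (p q x y : ℕ) {n : ℕ} (h : n = p * x + q * y := by omega)
    (hp : p ∈ P := by decide) (hq : q ∈ P := by decide) : PosOver P (1 - X ^ n) := by
  rw [h]
  exact one_sub_X_pow_add (one_sub_X_pow_mul (one_sub_X_pow_of_mem hp) x)
    (one_sub_X_pow_mul (one_sub_X_pow_of_mem hq) y)

theorem one_sub_X_pow_of_dvd (p : ℕ) {n : ℕ} (h : n % p = 0 := by omega)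
    (hp : p ∈ P := by decide) : PosOver P (1 - X ^ n) :=
  one_sub_X_pow_of_eq p p (n / p) 0 (by have := Nat.div_add_mod n p; omega) hp hp

theorem of_prod_eq {q : ℚ⟦X⟧} (P Q : Finset ℕ) {R : Finset ℕ} (hq : PosOver Q q)
    (e : f = (∏ p ∈ P, (1 - X ^ p)) * q)
    (h0 : 0 ∉ P := by decide) (h : Disjoint P Q := by decide)
    (hR : P ∪ Q ⊆ R := by decide) : PosOver R f := by
  rw [e]
  refine mul ?_ hq h hR
  unfold PosOver
  rw [prod_mul_partGen h0]
  exact .one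

/-- A certificate of positivity: after multiplication with some `1 - X ^ z`, the series `f` becomes
a product of factors `1 - X ^ p` with a series that is positive over the other parts. -/
theorem of_mul_eq {z : ℕ} {q : ℚ⟦X⟧} (P Q : Finset ℕ) {R : Finset ℕ} (hz : z ≠ 0)
    (hq : PosOver Q q) (e : (1 - X ^ z) * f = (∏ p ∈ P, (1 - X ^ p)) * q)
    (h0 : 0 ∉ P := by decide) (h : Disjoint P Q := by decide)
    (hR : P ∪ Q ⊆ R := by decide) : PosOver R f := by
  refine mono hR ?_
  have : f * partGen (P ∪ Q) = (1 - X ^ z)⁻¹ * (q * partGen Q) := by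
    rw [partGen_union h]
    linear_combination (1 - X ^ z)⁻¹ * partGen P * partGen Q * e
      + (1 - X ^ z)⁻¹ * q * partGen Q * prod_mul_partGen h0
      - f * partGen P * partGen Q * one_sub_X_pow_mul_inv hz
  unfold PosOver
  rw [this]
  exact (coeffNonneg_inv_one_sub_X_pow z).mul hq

end PosOver

/-! ### Decompositions of `pairTerm` and the parts congruent to `1` and `4` modulo `5` -/

/-- The part of the alternating series `∑ (-1) ^ l * t_{κ + 1 + l}` that belongs to its `i`-th hill
and to the valley behind it, without its leading power of `X`. Put `j = κ + 1 + 2 * i`. The cuts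
split `t_j = X ^ e * (1 - X ^ (2 * j + 1))` at the exponent `e + 2 * i`, and `t_{j + 2}` in the same
way; the hill consists of the remaining second part of `t_j` and of the beginning of `t_{j + 1}`. -/
noncomputable def pairTerm (κ i : ℕ) : ℚ⟦X⟧ :=
  (1 - X ^ (2 * κ + 2 * i + 3)) * (1 - X ^ (3 * κ + 4 * i + 5)) -
    X ^ (5 * κ + 6 * i + 8) * ((1 - X ^ (2 * i + 2)) * (1 - X ^ (κ + 4 * i + 5)))

/-- Comparison of the factors `1 - X ^ u` and `1 - X ^ v` with `1 - X ^ a` and `1 - X ^ b`, where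
`u - a = 2 * κ + 1` and `v - b = 2 * κ`. -/
theorem pairTerm_eq (κ i : ℕ) : pairTerm κ i =
    (1 - X ^ (2 * κ + 1)) * (1 - X ^ (3 * κ + 4 * i + 5)) +
    X ^ (2 * κ + 1) * ((1 - X ^ (2 * i + 2)) * (1 - X ^ (2 * κ))) +
    X ^ (4 * κ + 1) * ((1 - X ^ (2 * i + 2)) *
      ((1 - X ^ (κ + 4 * i + 5)) * (1 - X ^ (κ + 6 * i + 7)))) := by
  unfold pairTerm; ring

/-- The decomposition `pairTerm_eq` with the two comparisons made in the other order. -/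
theorem pairTerm_eq' (κ i : ℕ) : pairTerm κ i =
    (1 - X ^ (2 * κ)) * (1 - X ^ (2 * κ + 2 * i + 3)) +
    X ^ (2 * κ) * ((1 - X ^ (2 * κ + 1)) * (1 - X ^ (κ + 4 * i + 5))) +
    X ^ (4 * κ + 1) * ((1 - X ^ (2 * i + 2)) *
      ((1 - X ^ (κ + 4 * i + 5)) * (1 - X ^ (κ + 6 * i + 7)))) := by
  unfold pairTerm; ring

/-- In this decomposition the factor `1 - X ^ a` is split off from the middle of `1 - X ^ u`. The
position is free, which makes the last exponent variable. -/
theorem pairTerm_eq_of_add_eq {κ x x' : ℕ} (i : ℕ) (h : x + x' = 2 * κ + 1) : pairTerm κ i =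
    (1 - X ^ x) * (1 - X ^ (3 * κ + 4 * i + 5)) +
    X ^ (x + (2 * i + 2)) * ((1 - X ^ x') * (1 - X ^ (3 * κ + 4 * i + 5))) +
    X ^ x * ((1 - X ^ (2 * i + 2)) * ((1 - X ^ (2 * κ)) +
      X ^ (2 * κ) * ((1 - X ^ (κ + 4 * i + 5)) * (1 - X ^ (κ + 6 * i + 7 + x'))))) := by
  have hX : (X : ℚ⟦X⟧) * (X ^ κ) ^ 2 = X ^ x * X ^ x' := by
    rw [← pow_add, h]; ring
  unfold pairTerm
  linear_combination (-(X ^ i) ^ 2 * X ^ 2 * (1 - X ^ (3 * κ + 4 * i + 5)) -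
    (X ^ κ) ^ 3 * (X ^ i) ^ 6 * X ^ 7 * (1 - X ^ (2 * i + 2)) * (1 - X ^ (κ + 4 * i + 5))) * hX

theorem posOver_four_nine_eleven_fourteen {b : ℕ} (h : 8 ≤ b) (hb : b ≠ 10) :
    PosOver {4, 9, 11, 14} (1 - X ^ b) := by
  obtain h0 | h0 | h0 | h0 : b % 4 = 0 ∨ b % 4 = 1 ∨ b % 4 = 2 ∨ b % 4 = 3 := by omega
  · exact .one_sub_X_pow_of_dvd 4
  · exact .one_sub_X_pow_of_eq 4 9 ((b - 9) / 4) 1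
  · exact .one_sub_X_pow_of_eq 4 14 ((b - 14) / 4) 1
  · exact .one_sub_X_pow_of_eq 4 11 ((b - 11) / 4) 1

theorem pairTerm_posOver_of_add_eq {κ x x' : ℕ} (i : ℕ) (h : x + x' = 2 * κ + 1) {P : Finset ℕ}
    (hP : 1 ∉ P) (hv : PosOver P (1 - X ^ (3 * κ + 4 * i + 5))) (hκ : PosOver P (1 - X ^ (2 * κ)))
    (hy : PosOver P ((1 - X ^ (κ + 4 * i + 5)) * (1 - X ^ (κ + 6 * i + 7 + x')))) :
    PosOver ({1} ∪ P) (pairTerm κ i) := by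
  have h1 (n : ℕ) : PosOver {1} (1 - X ^ n) := .one_sub_X_pow_of_dvd 1
  have hd : Disjoint {1} P := by simpa using hP
  rw [pairTerm_eq_of_add_eq i h]
  exact (((h1 _).mul_union hd hv).add (((h1 _).mul_union hd hv).X_pow_mul _)).add
    (((h1 _).mul_union hd (hκ.add (hy.X_pow_mul _))).X_pow_mul _)

theorem pairTerm_zero_posOver {i : ℕ} (hi : 1 ≤ i) : PosOver {1, 4, 6, 9, 14} (pairTerm 0 i) := by
  -- with `x' = 1` the last exponent is `6 * i + 8`, a combination of `6` and `14`
  refine (pairTerm_posOver_of_add_eq (x := 0) (x' := 1) (P := {4, 6, 9, 14}) i rfl (by decide)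
    (.one_sub_X_pow_of_eq 4 9 (i - 1) 1) (.one_sub_X_pow_of_dvd 4)
    (.mul (P := {4, 9}) (Q := {6, 14}) (.one_sub_X_pow_of_eq 4 9 (i - 1) 1)
      (.one_sub_X_pow_of_eq 6 14 (i - 1) 1))).mono (by decide)

theorem pairTerm_one_posOver {i : ℕ} (hi : 1 ≤ i) :
    PosOver {1, 4, 6, 9, 14} (pairTerm 1 i) := by
  have h1 (n : ℕ) : PosOver {1} (1 - X ^ n) := .one_sub_X_pow_of_dvd 1
  have h2 : PosOver {4, 6} (1 - X ^ (2 * i + 2)) := by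
    obtain h | h : i % 2 = 1 ∨ i % 2 = 0 := by omega
    · exact .one_sub_X_pow_of_dvd 4
    · exact .one_sub_X_pow_of_eq 4 6 ((i - 2) / 2) 1
  have h3 : PosOver {4, 6, 9, 14} ((1 - X ^ (1 + 4 * i + 5)) * (1 - X ^ (1 + 6 * i + 7))) := by
    obtain rfl | rfl | h : i = 1 ∨ i = 2 ∨ 3 ≤ i := by omega
    · exact .mul (P := {4, 6}) (Q := {14}) (.one_sub_X_pow_of_eq 4 6 1 1)
        (.one_sub_X_pow_of_dvd 14)
    · exact .mul (P := {14}) (Q := {4}) (.one_sub_X_pow_of_dvd 14) (.one_sub_X_pow_of_dvd 4)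
    · exact .mul (P := {4, 9}) (Q := {6, 14}) (.one_sub_X_pow_of_eq 4 9 (i - 3) 2)
        (.one_sub_X_pow_of_eq 6 14 (i - 1) 1)
  rw [pairTerm_eq]
  exact ((PosOver.mul (Q := {4}) (h1 _) (.one_sub_X_pow_of_dvd 4)).add
    ((h2.mul (h1 _)).X_pow_mul _)).add (((h1 _).mul h3).X_pow_mul _)

theorem pairTerm_posOver_of_two_le {κ i : ℕ} (hκ : 2 ≤ κ) (h : κ ≠ 2 ∨ i ≠ 0) :
    PosOver {1, 4, 6, 9, 11, 14} (pairTerm κ i) := by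
  have hv : PosOver {4, 6, 9, 11, 14} (1 - X ^ (3 * κ + 4 * i + 5)) :=
    (posOver_four_nine_eleven_fourteen (by omega) (by omega)).mono (by decide)
  have h2 : PosOver {4, 6, 9, 11, 14} (1 - X ^ (2 * κ)) := by
    obtain h | h : κ % 2 = 0 ∨ κ % 2 = 1 := by omega
    · exact .one_sub_X_pow_of_dvd 4
    · exact .one_sub_X_pow_of_eq 4 6 ((κ - 3) / 2) 1
  by_cases h5 : κ = 5 ∧ i = 0
  · obtain ⟨rfl, rfl⟩ := h5
    exact (pairTerm_posOver_of_add_eq (x := 5) (x' := 6) (P := {4, 6, 9, 11, 14}) 0 rfl (by decide)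
      hv h2 (.mul (P := {4, 6}) (Q := {9}) (.one_sub_X_pow_of_eq 4 6 1 1)
        (.one_sub_X_pow_of_dvd 9))).mono (by decide)
  · -- `x'` makes the last exponent of the decomposition a multiple of `6`
    exact (pairTerm_posOver_of_add_eq (x := 2 * κ + 1 - (5 * κ + 5) % 6) (x' := (5 * κ + 5) % 6)
      (P := {4, 6, 9, 11, 14}) i (by omega) (by decide) hv h2
      (.mul (posOver_four_nine_eleven_fourteen (by omega) (by omega))
        (Q := {6}) (.one_sub_X_pow_of_dvd 6))).mono (by decide)

/-! ### Certificates for small indices -/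

theorem PosOver.list_sum {P : Finset ℕ} {l : List ℚ⟦X⟧} (h : ∀ f ∈ l, PosOver P f) :
    PosOver P l.sum := by
  induction l with
  | nil => exact .of_coeffNonneg P .zero
  | cons f l ih =>
    rw [List.sum_cons]
    exact (h f List.mem_cons_self).add (ih fun g hg => h g (List.mem_cons_of_mem f hg))

/-- A sum of monomials and of multiples `X ^ e * (1 - X ^ n)`, where every `n` is a combination of
two parts. -/
theorem PosOver.of_list {P : Finset ℕ} (l : List (ℕ × ℕ)) (m : List ℕ)
    (h : ∀ a ∈ l, ∃ p ∈ P, ∃ q ∈ P, ∃ x < 8, p * x ≤ a.2 ∧ (a.2 - p * x) % q = 0 := by decide) :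
    PosOver P ((l.map fun a => X ^ a.1 * (1 - X ^ a.2)).sum + (m.map (X ^ ·)).sum) := by
  refine .add (.list_sum ?_) (.list_sum ?_)
  · rintro _ hf
    obtain ⟨a, ha, rfl⟩ := List.mem_map.mp hf
    obtain ⟨p, hp, q, hq, x, -, hx, hr⟩ := h a ha
    have := Nat.div_add_mod (a.2 - p * x) q
    exact .X_pow_mul _ (.one_sub_X_pow_of_eq p q x ((a.2 - p * x) / q) (by omega) hp hq)
  · rintro _ hf
    obtain ⟨e, -, rfl⟩ := List.mem_map.mp hf
    exact .X_pow P e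

theorem pairTerm_zero_zero_posOver : PosOver {1, 4, 6, 9, 11, 14, 19} (pairTerm 0 0) :=
  .of_mul_eq (z := 36) {1, 4, 9} {6, 11, 14, 19} (by decide)
    (.of_list [(0, 37), (1, 6), (2, 34), (4, 11), (10, 6), (13, 20), (14, 11), (18, 6)]
      [22, 22, 26, 30, 31])
    (by simp [pairTerm]; ring)

theorem pairTerm_one_zero_posOver : PosOver {1, 4, 6, 9, 11, 14, 16} (pairTerm 1 0) :=
  .of_mul_eq (z := 12) {1, 4, 6} {9, 11, 14, 16} (by decide)
    (.of_list [(0, 22), (1, 20), (2, 16), (3, 14)]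
      [4, 4, 5, 6, 6, 7, 7, 8, 8, 9, 10, 10, 11, 12])
    (by simp [pairTerm]; ring)

theorem pairTerm_two_zero_posOver : PosOver {1, 4, 6, 9, 11} (pairTerm 2 0) :=
  .of_prod_eq {1, 9} {4, 6, 11}
    (.of_list [(0, 17), (1, 15)]
      [2, 3, 4, 5, 6, 9, 10])
    (by simp [pairTerm]; ring)

theorem pairTerm_one_zero_posOver_two_three : PosOver {2, 3, 7} (pairTerm 1 0) :=
  .of_prod_eq {2, 7} {3}
    (.of_list [(0, 12), (2, 3)]
      [4, 6])
    (by simp [pairTerm]; ring)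

theorem pairTerm_four_zero_posOver_two_three : PosOver {2, 3, 13, 22, 27} (pairTerm 4 0) :=
  .of_mul_eq (z := 6) {2, 3, 13} {22, 27} (by decide)
    (.of_list [(0, 27), (2, 22)]
      [3, 4, 5, 6, 7, 8, 9, 10, 12, 13, 15, 16, 18])
    (by simp [pairTerm]; ring)

theorem pairTerm_two_one_posOver_two_three : PosOver {2, 3, 7, 13, 18, 23, 27} (pairTerm 2 1) :=
  .of_mul_eq (z := 6) {2, 3, 13} {7, 18, 23, 27} (by decide)
    (.of_list [(0, 27), (2, 23), (3, 21), (4, 18)]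
      [5, 6, 7, 8, 10, 13, 16])
    (by simp [pairTerm]; ring)

theorem pairTerm_one_one_posOver_two_three : PosOver {2, 3, 7, 8, 13, 18} (pairTerm 1 1) :=
  .of_mul_eq (z := 39) {2, 3, 13} {7, 8, 18} (by decide)
    (.of_list [(0, 54), (2, 50), (3, 48), (4, 45), (5, 43), (6, 39), (6, 40), (8, 31), (8, 35),
      (9, 24)]
      [10, 11, 12, 13, 14, 15, 16, 17, 18, 19, 21, 23, 26, 29, 29, 31, 32, 32, 34, 35, 38, 44])
    (by simp [pairTerm]; ring)

theorem pairTerm_zero_one_posOver_two_three : PosOver {2, 3, 7, 8, 12, 13, 23} (pairTerm 0 1) :=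
  .of_mul_eq (z := 26) {2, 3, 13} {7, 8, 12, 23} (by decide)
    (.of_list [(0, 35), (2, 31), (3, 29), (4, 7), (6, 23), (6, 24), (8, 19), (10, 7)]
      [12, 16, 18])
    (by simp [pairTerm]; ring)

/-- Over the parts `2, 3, 7, 8, 13`, the only negative coefficients of `pairTerm 0 0` are those
of `X ^ 5` and `X ^ 11`, and both are at least `-1`. -/
theorem pairTerm_zero_zero_add_posOver : PosOver {2, 3, 7, 8, 13} (pairTerm 0 0 + (X ^ 5 + X ^ 11) *
    ∏ p ∈ {2, 3, 7, 8, 13}, (1 - X ^ p)) :=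
  .of_mul_eq (z := 42) {2, 3, 7} {8, 13} (by decide)
    (.of_list [(0, 21), (2, 13), (4, 13), (6, 13), (10, 8), (16, 8), (16, 13), (20, 13), (22, 13),
      (26, 13), (28, 40), (32, 42), (34, 8), (34, 13), (37, 8), (40, 13)]
      [30, 55, 60, 61, 66])
    (by simp [pairTerm]; ring)

/-! ### The parts congruent to `2` and `3` modulo `5` -/

theorem posOver_three_eight_thirteen {b : ℕ} (h : 6 ≤ b) (h7 : b ≠ 7) (h10 : b ≠ 10) :
    PosOver {3, 8, 13} (1 - X ^ b) := by
  obtain h0 | h0 | h0 : b % 3 = 0 ∨ b % 3 = 1 ∨ b % 3 = 2 := by omega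
  · exact .one_sub_X_pow_of_dvd 3
  · exact .one_sub_X_pow_of_eq 3 13 ((b - 13) / 3) 1
  · exact .one_sub_X_pow_of_eq 3 8 ((b - 8) / 3) 1

theorem posOver_seven_twelve {c : ℕ} (h : 17 ≤ c) (h20 : c ≠ 20) :
    PosOver {7, 12, 17, 18, 22, 23, 27} (1 - X ^ c) := by
  have : c % 7 < 7 := Nat.mod_lt _ (by norm_num)
  interval_cases h0 : c % 7
  · exact .one_sub_X_pow_of_dvd 7
  · exact .one_sub_X_pow_of_eq 7 22 ((c - 22) / 7) 1
  · exact .one_sub_X_pow_of_eq 7 23 ((c - 23) / 7) 1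
  · exact .one_sub_X_pow_of_eq 7 17 ((c - 17) / 7) 1
  · exact .one_sub_X_pow_of_eq 7 18 ((c - 18) / 7) 1
  · exact .one_sub_X_pow_of_eq 7 12 ((c - 12) / 7) 1
  · exact .one_sub_X_pow_of_eq 7 27 ((c - 27) / 7) 1

/-- The two larger factors of the product of three factors in `pairTerm_eq'`; the smallest one is
left to the part `2`. -/
theorem posOver_pair {κ i : ℕ} (hκ : 1 ≤ κ)
    (h : (κ, i) ∉ ({(1, 0), (4, 0), (2, 1), (1, 1)} : Finset (ℕ × ℕ))) :
    PosOver {3, 7, 8, 12, 13, 17, 18, 22, 23, 27}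
      ((1 - X ^ (κ + 4 * i + 5)) * (1 - X ^ (κ + 6 * i + 7))) := by
  simp only [Finset.mem_insert, Finset.mem_singleton, Prod.mk.injEq] at h
  by_cases hc : 17 ≤ κ + 6 * i + 7 ∧ κ + 6 * i + 7 ≠ 20
  · exact .mul (posOver_three_eight_thirteen (by omega) (by omega) (by omega))
      (posOver_seven_twelve hc.1 hc.2)
  obtain ⟨rfl, hk⟩ | ⟨rfl, hk⟩ | ⟨rfl, rfl⟩ :
      (i = 0 ∧ (κ = 2 ∨ κ = 3 ∨ κ = 5 ∨ κ = 6 ∨ κ = 7 ∨ κ = 8 ∨ κ = 9 ∨ κ = 13)) ∨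
      (i = 1 ∧ (κ = 3 ∨ κ = 7)) ∨ (i = 2 ∧ κ = 1) := by omega
  · obtain rfl | rfl | rfl | rfl | rfl | rfl | rfl | rfl := hk
    · exact .mul (P := {7}) (Q := {3}) (.one_sub_X_pow_of_dvd 7) (.one_sub_X_pow_of_dvd 3)
    · exact .mul (P := {8}) (Q := {3, 7}) (.one_sub_X_pow_of_dvd 8) (.one_sub_X_pow_of_eq 3 7 1 1)
    · exact .mul (P := {3, 7}) (Q := {12}) (.one_sub_X_pow_of_eq 3 7 1 1) (.one_sub_X_pow_of_dvd 12)
    · exact .mul (P := {3, 8}) (Q := {13}) (.one_sub_X_pow_of_eq 3 8 1 1) (.one_sub_X_pow_of_dvd 13)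
    · exact .mul (P := {3}) (Q := {7}) (.one_sub_X_pow_of_dvd 3) (.one_sub_X_pow_of_dvd 7)
    · exact .mul (P := {13}) (Q := {3}) (.one_sub_X_pow_of_dvd 13) (.one_sub_X_pow_of_dvd 3)
    · exact .mul (P := {7}) (Q := {8}) (.one_sub_X_pow_of_dvd 7) (.one_sub_X_pow_of_dvd 8)
    · exact .mul (P := {18}) (Q := {7, 13}) (.one_sub_X_pow_of_dvd 18)
        (.one_sub_X_pow_of_eq 7 13 1 1)
  · obtain rfl | rfl := hk
    · exact .mul (P := {12}) (Q := {8}) (.one_sub_X_pow_of_dvd 12) (.one_sub_X_pow_of_dvd 8)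
    · exact .mul (P := {8}) (Q := {7, 13}) (.one_sub_X_pow_of_dvd 8)
        (.one_sub_X_pow_of_eq 7 13 1 1)
  · exact .mul (P := {7}) (Q := {8, 12}) (.one_sub_X_pow_of_dvd 7)
      (.one_sub_X_pow_of_eq 8 12 1 1)

theorem pairTerm_posOver_of_one_le {κ i : ℕ} (hκ : 1 ≤ κ) :
    PosOver {2, 3, 7, 8, 12, 13, 17, 18, 22, 23, 27} (pairTerm κ i) := by
  by_cases h : (κ, i) ∈ ({(1, 0), (4, 0), (2, 1), (1, 1)} : Finset (ℕ × ℕ))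
  · simp only [Finset.mem_insert, Finset.mem_singleton, Prod.mk.injEq] at h
    obtain ⟨rfl, rfl⟩ | ⟨rfl, rfl⟩ | ⟨rfl, rfl⟩ | ⟨rfl, rfl⟩ := h
    · exact pairTerm_one_zero_posOver_two_three.mono (by decide)
    · exact pairTerm_four_zero_posOver_two_three.mono (by decide)
    · exact pairTerm_two_one_posOver_two_three.mono (by decide)
    · exact pairTerm_one_one_posOver_two_three.mono (by decide)
  have h1 := posOver_pair hκ h
  simp only [Finset.mem_insert, Finset.mem_singleton, Prod.mk.injEq] at h
  have h2 (n : ℕ) : PosOver {2} (1 - X ^ (2 * n)) := .one_sub_X_pow_of_dvd 2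
  have h3 : PosOver {3, 7, 8} (1 - X ^ (2 * κ + 2 * i + 3)) := by
    obtain h0 | h0 | h0 : (2 * κ + 2 * i + 3) % 3 = 0 ∨ (2 * κ + 2 * i + 3) % 3 = 1 ∨
      (2 * κ + 2 * i + 3) % 3 = 2 := by omega
    · exact .one_sub_X_pow_of_dvd 3
    · exact .one_sub_X_pow_of_eq 3 7 ((2 * κ + 2 * i + 3 - 7) / 3) 1
    · exact .one_sub_X_pow_of_eq 3 8 ((2 * κ + 2 * i + 3 - 8) / 3) 1
  have h4 : PosOver {2, 3, 7, 8, 12, 13, 17, 18, 22, 23, 27}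
      ((1 - X ^ (2 * κ + 1)) * (1 - X ^ (κ + 4 * i + 5))) := by
    obtain rfl | rfl | hκ : κ = 1 ∨ κ = 2 ∨ 3 ≤ κ := by omega
    · exact .mul (P := {3}) (Q := {2}) (.one_sub_X_pow_of_dvd 3) (.one_sub_X_pow_of_dvd 2)
    · refine .mul (P := {2, 3}) (Q := {7, 8, 12}) (.one_sub_X_pow_of_eq 2 3 1 1) ?_
      obtain h0 | h0 : i % 2 = 0 ∨ i % 2 = 1 := by omega
      · exact .one_sub_X_pow_of_eq 8 7 (i / 2) 1
      · -- `19 = 7 + 12` is the least admissible exponent in this class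
        have : PosOver {7, 8, 12} (1 - X ^ (7 * 1 + 12 * 1)) := .one_sub_X_pow_of_eq 7 12 1 1
        have h5 := this.one_sub_X_pow_add (n := 8 * ((i - 3) / 2)) (.one_sub_X_pow_of_dvd 8)
        rwa [show 7 * 1 + 12 * 1 + 8 * ((i - 3) / 2) = 2 + 4 * i + 5 by omega] at h5
    · by_cases h5 : κ = 5 ∧ i = 0
      · obtain ⟨rfl, rfl⟩ := h5
        exact .mul (P := {3, 8}) (Q := {2}) (.one_sub_X_pow_of_eq 3 8 1 1)
          (.one_sub_X_pow_of_dvd 2)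
      · exact .mul (P := {2, 7}) (.one_sub_X_pow_of_eq 2 7 (κ - 3) 1)
          (posOver_three_eight_thirteen (by omega) (by omega) (by omega))
  have h6 : PosOver {2} (1 - X ^ (2 * i + 2)) := h2 (i + 1)
  rw [pairTerm_eq']
  exact (((h2 _).mul h3).add (h4.X_pow_mul _)).add ((h6.mul h1).X_pow_mul _)

/-- The factor of `pairTerm 0 i` besides `1 - X ^ (4 * i + 5)`. Divided by
`(1 - X ^ 2) * (1 - X ^ 3) * (1 - X ^ 7)`, the summand `1 - X` has the single negative term `-X`,
which is cancelled by the leading term of the quotient of the second summand. -/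
theorem one_sub_X_add_posOver {i : ℕ} : PosOver {2, 3, 7}
    (1 - X + X * ((1 - X ^ (2 * i + 2)) * (1 - X ^ (6 * i + 7)))) := by
  -- the product with the least exponents already compensates the negative part of `1 - X`
  have h0 : PosOver {2, 3, 7} (1 - X + X * ((1 - X ^ 2) * (1 - X ^ 3) * (1 - X ^ 7)) -
      X ^ 2 * ((1 - X ^ 2) * (1 - X ^ 3))) := by
    refine .of_mul_eq (z := 6) {2, 3} {7} (by decide)
      (.of_list [(0, 7)] [14]) ?_
    simp
    ring
  have h2 (n : ℕ) : PosOver {2} (1 - X ^ (2 * n)) := .one_sub_X_pow_of_dvd 2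
  have h3 (n : ℕ) : PosOver {3} (1 - X ^ (3 * n)) := .one_sub_X_pow_of_dvd 3
  have h7 : PosOver {7} (1 - X ^ 7) := .one_sub_X_pow_of_dvd 7
  have h37 : PosOver {3, 7} (1 - X ^ (6 * i + 7)) := .one_sub_X_pow_of_eq 3 7 (2 * i) 1
  have e : (1 - X + X * ((1 - X ^ (2 * i + 2)) * (1 - X ^ (6 * i + 7))) : ℚ⟦X⟧) =
      (1 - X + X * ((1 - X ^ 2) * (1 - X ^ 3) * (1 - X ^ 7)) -
        X ^ 2 * ((1 - X ^ 2) * (1 - X ^ 3))) +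
      X ^ 2 * ((1 - X ^ (2 * 1)) * (1 - X ^ (3 * 1))) +
      X ^ 4 * ((1 - X ^ (2 * 1)) * (1 - X ^ 7)) +
      X ^ 8 * ((1 - X ^ (2 * 1)) * (1 - X ^ (3 * (2 * i)))) +
      X ^ 3 * ((1 - X ^ (2 * i)) * (1 - X ^ (6 * i + 7))) := by ring
  rw [e]
  exact (((h0.add (((h2 1).mul (h3 1)).X_pow_mul 2)).add (((h2 1).mul h7).X_pow_mul 4)).add
    (((h2 1).mul (h3 (2 * i))).X_pow_mul 8)).add
    (((h2 i).mul h37).X_pow_mul 3)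

theorem pairTerm_zero_posOver_two_three {i : ℕ} (hi : 1 ≤ i) :
    PosOver {2, 3, 7, 8, 12, 13, 17, 23} (pairTerm 0 i) := by
  obtain rfl | hi : i = 1 ∨ 2 ≤ i := by omega
  · exact pairTerm_zero_one_posOver_two_three.mono (by decide)
  have h : PosOver {8, 12, 13, 17} (1 - X ^ (4 * i + 5)) := by
    obtain h0 | h0 : i % 2 = 0 ∨ i % 2 = 1 := by omega
    · exact .one_sub_X_pow_of_eq 8 13 ((i - 2) / 2) 1
    · exact .one_sub_X_pow_of_eq 8 17 ((i - 3) / 2) 1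
  have e : pairTerm 0 i = (1 - X ^ (4 * i + 5)) *
      (1 - X + X * ((1 - X ^ (2 * i + 2)) * (1 - X ^ (6 * i + 7)))) := by
    unfold pairTerm; ring
  rw [e]
  exact .mul h one_sub_X_add_posOver

/-! ### The exceptional term -/

/-- The polynomial with the given list of coefficients, in ascending order. -/
noncomputable def ofCoeffs : List ℤ → ℚ⟦X⟧
  | [] => 0
  | a :: l => (a : ℚ⟦X⟧) + X * ofCoeffs l

theorem coeff_ofCoeffs (l : List ℤ) (n : ℕ) : coeff n (ofCoeffs l) = (l.getD n 0 : ℤ) := by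
  induction l generalizing n with
  | nil => simp [ofCoeffs]
  | cons a l ih =>
    have h : ((a : ℤ) : ℚ⟦X⟧) = C (a : ℚ) := by simp
    cases n with
    | zero => simp [ofCoeffs]
    | succ n => rw [ofCoeffs, map_add, coeff_succ_X_mul, ih, h, coeff_C]; simp

theorem coeff_mul_partGen_of_lt {P : Finset ℕ} {m n : ℕ} (hP : ∀ p ∈ P, m ≤ p) (hn : n < m)
    (f : ℚ⟦X⟧) : coeff n (f * partGen P) = coeff n f := by
  induction P using Finset.induction_on with
  | empty => simp [partGen]
  | insert p P hp ih =>
    have h := hP p (Finset.mem_insert_self p P)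
    rw [partGen, Finset.prod_insert hp, mul_comm (1 - X ^ p)⁻¹, ← mul_assoc,
      coeff_mul_inv_one_sub_X_pow (by omega), if_neg (by omega), add_zero]
    exact ih fun q hq => hP q (Finset.mem_insert_of_mem hq)

/-- A negative part `-w` of `f` does not spread when `f` is divided by the factors `1 - X ^ p`, if
`f` contains the terms `w * X ^ p` which would become negative. -/
theorem coeffNonneg_mul_partGen_add {f w : ℚ⟦X⟧} (hw : CoeffNonneg w) (P : Finset ℕ) (h0 : 0 ∉ P)
    (T : Finset ℕ) (hT : Disjoint P T) (h : CoeffNonneg (f + w - w * ∑ p ∈ P ∪ T, X ^ p)) :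
    CoeffNonneg (f * partGen P + w - w * ∑ p ∈ T, X ^ p) := by
  induction P using Finset.induction_on generalizing T with
  | empty => simpa [partGen] using h
  | insert p P hp ih =>
    rw [Finset.disjoint_insert_left] at hT
    have h1 : p ≠ 0 := by rintro rfl; exact h0 (Finset.mem_insert_self 0 P)
    have h2 := ih (fun h => h0 (Finset.mem_insert_of_mem h)) (insert p T)
      (Finset.disjoint_insert_right.mpr ⟨hp, hT.2⟩)
      (by rwa [Finset.union_insert, ← Finset.insert_union])
    rw [Finset.sum_insert hT.1] at h2
    have h3 : f * partGen (insert p P) + w - w * ∑ q ∈ T, X ^ q =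
        (f * partGen P + w - w * (X ^ p + ∑ q ∈ T, X ^ q)) * (1 - X ^ p)⁻¹ +
          w * (∑ q ∈ T, X ^ q) * (X ^ p * (1 - X ^ p)⁻¹) := by
      rw [partGen, Finset.prod_insert hp, ← partGen]
      linear_combination (w * ∑ q ∈ T, X ^ q - w) * one_sub_X_pow_mul_inv h1
    rw [h3]
    refine (CoeffNonneg.mul h2 (coeffNonneg_inv_one_sub_X_pow p)).add ((hw.mul ?_).mul
      ((CoeffNonneg.X_pow p).mul (coeffNonneg_inv_one_sub_X_pow p)))
    intro n
    rw [map_sum]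
    exact Finset.sum_nonneg fun q _ => CoeffNonneg.X_pow q n

/-- The first coefficients of `pairTerm 0 0 * partGen {2, 3, 7, 8, 13, 17}`. -/
def firstCoeffs : List ℤ :=
  [1, 0, 1, 0, 1, -1, 1, 0, 1, 0, 2, -1, 1, 1, 1, 0, 3, 1, 1, 1, 2, 1, 1, 2, 2, 1, 3, 2, 2, 2, 4,
    1, 3, 3, 5, 1, 5, 3, 4, 2, 6, 3, 6, 4, 6, 3, 6, 5, 6, 5, 8, 6, 7]

/-- The table determines `pairTerm 0 0` up to an explicit multiple of `X ^ 53`. -/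
theorem coeff_pairTerm_zero_zero_of_lt {n : ℕ} (hn : n < 53) :
    coeff n (pairTerm 0 0 * partGen {2, 3, 7, 8, 13, 17}) = (firstCoeffs.getD n 0 : ℤ) := by
  have h : pairTerm 0 0 = (∏ p ∈ {2, 3, 7, 8, 13, 17}, (1 - X ^ p)) * ofCoeffs firstCoeffs +
      X ^ 53 * ofCoeffs [6, 8, 1, -6, -8, 1, 0, -6, -15, -9, 5, 15, 8, -7, -9, 7, 15, 1, -17, -9,
        13, 23, 8, -6, -7, 9, 10, -6, -22, -16, 7, 15, 1, -15, -7, 8, 8, -8, -15, -9, 6, 13, 7, -1,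
        1, 8, 8, -1, -6, -7] := by
    simp [pairTerm, firstCoeffs, ofCoeffs]
    ring
  have h1 := prod_mul_partGen (P := {2, 3, 7, 8, 13, 17}) (by decide)
  rw [h, add_mul, mul_right_comm, h1, one_mul, map_add, mul_assoc, coeff_X_pow_mul',
    if_neg (by omega), add_zero, coeff_ofCoeffs]

/-- The table covers a full period `36, …, 52` of the part `17`, and the division by `1 - X ^ 17`
propagates the bound since the coefficients over the other parts are nonnegative. -/
theorem two_le_coeff_pairTerm_zero_zero {n : ℕ} (hn : 36 ≤ n) :
    2 ≤ coeff n (pairTerm 0 0 * partGen {2, 3, 7, 8, 13, 17}) := by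
  induction n using Nat.strong_induction_on with
  | _ n ih =>
    by_cases h : n < 53
    · rw [coeff_pairTerm_zero_zero_of_lt h]
      have : ∀ n < 53, 36 ≤ n → 2 ≤ firstCoeffs.getD n 0 := by decide
      exact_mod_cast this n h hn
    · have h1 : partGen {2, 3, 7, 8, 13, 17} = partGen {2, 3, 7, 8, 13} * (1 - X ^ 17)⁻¹ := by
        rw [show ({2, 3, 7, 8, 13, 17} : Finset ℕ) = {2, 3, 7, 8, 13} ∪ {17} by decide,
          partGen_union (by decide)]
        simp [partGen]
      have h2 := pairTerm_zero_zero_add_posOver n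
      rw [add_mul, mul_assoc, prod_mul_partGen (by decide), mul_one, map_add, map_add,
        coeff_X_pow, coeff_X_pow, if_neg (by omega), if_neg (by omega)] at h2
      have h3 := ih (n - 17) (by omega) (by omega)
      rw [h1, ← mul_assoc] at h3 ⊢
      rw [coeff_mul_inv_one_sub_X_pow (by norm_num), if_pos (by omega)]
      linarith

theorem coeffNonneg_pairTerm_zero_zero_add {P : Finset ℕ} (hP : {2, 3, 7, 8, 13, 17} ⊆ P)
    (h : ∀ p ∈ P, p % 5 = 2 ∨ p % 5 = 3) :
    CoeffNonneg (pairTerm 0 0 * partGen P + (X ^ 5 + X ^ 11)) := by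
  have hw : CoeffNonneg (X ^ 5 + X ^ 11) := (CoeffNonneg.X_pow 5).add (.X_pow 11)
  have hd : Disjoint (P \ {2, 3, 7, 8, 13, 17}) ∅ := Finset.disjoint_empty_right _
  have h0 : 0 ∉ P \ {2, 3, 7, 8, 13, 17} := fun h1 => by
    have := h 0 (Finset.mem_sdiff.mp h1).1
    omega
  have key := coeffNonneg_mul_partGen_add (f := pairTerm 0 0 * partGen {2, 3, 7, 8, 13, 17})
    hw _ h0 ∅ hd ?_
  · rw [Finset.sum_empty, mul_zero, sub_zero, mul_assoc,
      ← partGen_union Finset.disjoint_sdiff, Finset.union_sdiff_of_subset hP] at key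
    exact key
  rw [Finset.union_empty]
  intro n
  -- the parts outside `{2, 3, 7, 8, 13, 17}` contribute at most one term to every coefficient
  have hs (e : ℕ) : coeff n (X ^ e * ∑ p ∈ P \ {2, 3, 7, 8, 13, 17}, X ^ p : ℚ⟦X⟧) ≤
      if e + 12 ≤ n ∧ n ≠ e + 13 ∧ n ≠ e + 17 ∧ ((n - e) % 5 = 2 ∨ (n - e) % 5 = 3)
      then 1 else 0 := by
    rw [coeff_X_pow_mul', map_sum]
    simp only [coeff_X_pow, Finset.sum_ite_eq]
    by_cases h1 : e ≤ n
    · rw [if_pos h1]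
      by_cases h2 : n - e ∈ P \ {2, 3, 7, 8, 13, 17}
      · rw [if_pos h2, if_pos]
        have h3 := h _ (Finset.mem_sdiff.mp h2).1
        simp only [Finset.mem_sdiff, Finset.mem_insert, Finset.mem_singleton] at h2
        omega
      · rw [if_neg h2]
        split_ifs <;> norm_num
    · rw [if_neg h1]
      split_ifs <;> norm_num
  have h5 := hs 5
  have h11 := hs 11
  rw [add_mul, map_sub, map_add, map_add, map_add]
  by_cases hn : n < 53
  · have ht : ∀ n < 53, (if 5 + 12 ≤ n ∧ n ≠ 5 + 13 ∧ n ≠ 5 + 17 ∧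
        ((n - 5) % 5 = 2 ∨ (n - 5) % 5 = 3) then 1 else 0) +
        (if 11 + 12 ≤ n ∧ n ≠ 11 + 13 ∧ n ≠ 11 + 17 ∧
        ((n - 11) % 5 = 2 ∨ (n - 11) % 5 = 3) then 1 else 0) ≤
        firstCoeffs.getD n 0 + ((if n = 5 then 1 else 0) + if n = 11 then 1 else 0) := by decide
    have ht' := (Int.cast_le (R := ℚ)).mpr (ht n hn)
    simp only [Int.cast_add, Int.cast_ite, Int.cast_one, Int.cast_zero] at ht'
    rw [coeff_pairTerm_zero_zero_of_lt hn, coeff_X_pow, coeff_X_pow]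
    linarith
  · have h2 := two_le_coeff_pairTerm_zero_zero (n := n) (by omega)
    rw [coeff_X_pow, coeff_X_pow, if_neg (by omega), if_neg (by omega)]
    have h1 (p : Prop) [Decidable p] : (if p then 1 else 0 : ℚ) ≤ 1 := by split_ifs <;> norm_num
    linarith [h5.trans (h1 _), h11.trans (h1 _)]

theorem coeff_pairTerm_zero_zero {P : Finset ℕ} (hP : {2, 3, 7, 8, 13, 17} ⊆ P)
    (h : ∀ p ∈ P, p % 5 = 2 ∨ p % 5 = 3) {n : ℕ} (hn : n < 12) :
    coeff n (pairTerm 0 0 * partGen P) = (firstCoeffs.getD n 0 : ℤ) := by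
  rw [← Finset.union_sdiff_of_subset hP, partGen_union Finset.disjoint_sdiff, ← mul_assoc,
    coeff_mul_partGen_of_lt (m := 12) (fun p hp => ?_) hn,
    coeff_pairTerm_zero_zero_of_lt (by omega)]
  have h1 := h p (Finset.mem_sdiff.mp hp).1
  simp only [Finset.mem_sdiff, Finset.mem_insert, Finset.mem_singleton] at hp
  omega

/-! ### Truncation of infinite products -/

theorem coeff_tsum {ι : Type*} {f : ι → ℚ⟦X⟧} (hf : Summable f) (n : ℕ) :
    coeff n (∑' i, f i) = ∑' i, coeff n (f i) :=
  ((hf.hasSum.map (coeff n) (WithPiTopology.continuous_coeff ℚ n)).tsum_eq).symm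

theorem X_pow_dvd_tsum {ι : Type*} {f : ι → ℚ⟦X⟧} {d : ℕ} (hf : Summable f)
    (h : ∀ i, X ^ d ∣ f i) : X ^ d ∣ ∑' i, f i := by
  rw [X_pow_dvd_iff]
  intro n hn
  rw [coeff_tsum hf]
  simp [X_pow_dvd_iff.mp (h _) n hn]

/-- Power series that are congruent modulo every power of `X` are equal. -/
theorem eq_of_forall_X_pow_dvd_sub {f g : ℚ⟦X⟧} (h : ∀ d, X ^ d ∣ f - g) : f = g := by
  ext n
  have := X_pow_dvd_iff.mp (h (n + 1)) n (Nat.lt_succ_self n)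
  rwa [map_sub, sub_eq_zero] at this

theorem X_pow_dvd_one_sub_prod {ι : Type*} {f : ι → ℚ⟦X⟧} {d : ℕ} (s : Finset ι)
    (h : ∀ i, X ^ d ∣ 1 - f i) : X ^ d ∣ 1 - ∏ i ∈ s, f i := by
  classical
  induction s using Finset.induction_on with
  | empty => simp
  | insert a s ha ih =>
    rw [Finset.prod_insert ha]
    have : (1 - f a * ∏ i ∈ s, f i) = (1 - f a) + f a * (1 - ∏ i ∈ s, f i) := by ring
    rw [this]
    exact dvd_add (h a) (ih.mul_left _)

theorem X_pow_dvd_one_sub_qShiftedInf {a q : ℚ⟦X⟧} {d : ℕ} (hq : constantCoeff q = 0)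
    (ha : X ^ d ∣ a) : X ^ d ∣ 1 - qShiftedInf a q := by
  have hf (j : ℕ) : X ^ d ∣ 1 - (1 - a * q ^ j) := by
    rw [sub_sub_cancel]; exact ha.mul_right _
  rw [X_pow_dvd_iff]
  intro n hn
  rw [map_sub, sub_eq_zero]
  have h1 := ((WithPiTopology.continuous_coeff ℚ n).tendsto _).comp
    (multipliable_qShiftedInf a q hq).hasProd
  refine tendsto_nhds_unique ?_ h1
  refine tendsto_const_nhds.congr fun s => ?_
  have h2 := X_pow_dvd_iff.mp (X_pow_dvd_one_sub_prod s hf) n hn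
  rw [map_sub, sub_eq_zero] at h2
  exact h2

theorem X_pow_dvd_qShifted_sub_qShiftedInf (c N : ℕ) {d : ℕ} (hd : 0 < d) :
    X ^ (d * N) ∣ qShifted (X ^ c) (X ^ d) N - qShiftedInf (X ^ c) (X ^ d) := by
  have hq : constantCoeff (X ^ d : ℚ⟦X⟧) = 0 := by simp [hd.ne']
  have h := X_pow_dvd_one_sub_qShiftedInf (a := X ^ c * (X ^ d) ^ N) hq
    ((pow_mul (X : ℚ⟦X⟧) d N).dvd.trans (Dvd.intro_left _ rfl))
  rw [← qShifted_mul_qShiftedInf _ _ hq N]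
  exact (h.mul_left (qShifted (X ^ c) (X ^ d) N)).trans (by rw [mul_sub, mul_one])

theorem qShifted_succ (a q : ℚ⟦X⟧) (n : ℕ) :
    qShifted a q (n + 1) = qShifted a q n * (1 - a * q ^ n) := Finset.prod_range_succ _ _

theorem constantCoeff_qShifted {c : ℕ} (hc : c ≠ 0) (q : ℚ⟦X⟧) (n : ℕ) :
    constantCoeff (qShifted (X ^ c) q n) = 1 := by
  simp [qShifted, hc]

/-- The factors of `(X; X)_∞` sorted by the residue class of the exponent modulo `5`. -/
theorem qShiftedInf_X_X : qShiftedInf X X = qShiftedInf X (X ^ 5) * qShiftedInf (X ^ 4) (X ^ 5) *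
    (qShiftedInf (X ^ 2) (X ^ 5) * qShiftedInf (X ^ 3) (X ^ 5) * qShiftedInf (X ^ 5) (X ^ 5)) := by
  have hfin (N : ℕ) : qShifted X X (5 * N) = qShifted (X ^ 1) (X ^ 5) N *
      qShifted (X ^ 4) (X ^ 5) N * (qShifted (X ^ 2) (X ^ 5) N * qShifted (X ^ 3) (X ^ 5) N *
      qShifted (X ^ 5) (X ^ 5) N) := by
    induction N with
    | zero => simp [qShifted]
    | succ N ih =>
      rw [show 5 * (N + 1) = 5 * N + 1 + 1 + 1 + 1 + 1 by ring]
      simp only [qShifted_succ, ih]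
      ring
  have h (c N : ℕ) := Ideal.Quotient.eq.mpr (Ideal.mem_span_singleton.mpr
    (X_pow_dvd_qShifted_sub_qShiftedInf c N (d := 5) (by norm_num)))
  refine eq_of_forall_X_pow_dvd_sub fun N => (pow_dvd_pow X (show N ≤ 5 * N by omega)).trans ?_
  have h1 := X_pow_dvd_qShifted_sub_qShiftedInf 1 (5 * N) (d := 1) one_pos
  rw [pow_one, one_mul] at h1
  rw [← Ideal.mem_span_singleton, ← Ideal.Quotient.eq] at h1 ⊢
  have hX : qShiftedInf X (X ^ 5) = qShiftedInf (X ^ 1) (X ^ 5) := by rw [pow_one]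
  rw [← h1, hfin, hX]
  simp only [map_mul, h]

/-- The parts below `5 * N` that are congruent to `r` or `s` modulo `5`. -/
def partsMod (r s N : ℕ) : Finset ℕ := (Finset.range (5 * N)).filter fun p => p % 5 = r ∨ p % 5 = s

theorem prod_partsMod {r s : ℕ} (hr : r < 5) (hs : s < 5) (hrs : r ≠ s) (N : ℕ) :
    ∏ p ∈ partsMod r s N, (1 - X ^ p : ℚ⟦X⟧) =
      qShifted (X ^ r) (X ^ 5) N * qShifted (X ^ s) (X ^ 5) N := by
  unfold partsMod
  rw [Finset.prod_filter]
  induction N with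
  | zero => simp [qShifted]
  | succ N ih =>
    rw [show 5 * (N + 1) = 5 * N + 1 + 1 + 1 + 1 + 1 by ring]
    simp only [Finset.prod_range_succ, qShifted_succ, ih]
    have h (j : ℕ) (hj : j < 5) : (5 * N + j) % 5 = j := by omega
    have h0 := h 0 (by norm_num)
    have h1 := h 1 (by norm_num)
    have h2 := h 2 (by norm_num)
    have h3 := h 3 (by norm_num)
    have h4 := h 4 (by norm_num)
    simp only [h1, h2, h3, h4, add_zero] at h0 ⊢
    rw [h0]
    interval_cases r <;> interval_cases s <;> first | exact absurd rfl hrs | (simp; ring)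

/-! ### The truncated pentagonal number series -/

theorem summable_of_X_pow_dvd {f : ℕ → ℚ⟦X⟧} (h : ∀ m, X ^ m ∣ f m) : Summable f := by
  rw [PowerSeries.WithPiTopology.summable_iff_summable_coeff]
  intro d
  refine summable_of_hasFiniteSupport ((Set.finite_Iic d).subset fun m hm => ?_)
  by_contra hmd
  exact hm (X_pow_dvd_iff.mp (h m) d (by simpa using hmd))

theorem qShifted_X_X_mul_inv (n : ℕ) : qShifted X X n * (qShifted X X n)⁻¹ = 1 := by
  refine PowerSeries.mul_inv_cancel _ ?_
  have := constantCoeff_qShifted one_ne_zero X n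
  rw [pow_one] at this
  rw [this]
  exact one_ne_zero

theorem qShifted_X_X_inv_succ (n : ℕ) :
    (qShifted X X n)⁻¹ = (1 - X ^ (n + 1)) * (qShifted X X (n + 1))⁻¹ := by
  have h := qShifted_X_X_mul_inv (n + 1)
  rw [qShifted_succ] at h ⊢
  linear_combination (-(qShifted X X n)⁻¹) * h + (1 - X ^ (n + 1)) *
    (qShifted X X n * (1 - X * X ^ n))⁻¹ * qShifted_X_X_mul_inv n

/-- Euler's series `∑ z ^ m / (X; X)_m` at `z = X ^ c`. -/
noncomputable def eulerSeries (c : ℕ) : ℚ⟦X⟧ := ∑' m : ℕ, X ^ (c * m) * (qShifted X X m)⁻¹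

theorem summable_eulerSeries {c : ℕ} (hc : 0 < c) :
    Summable fun m : ℕ => (X ^ (c * m) * (qShifted X X m)⁻¹ : ℚ⟦X⟧) :=
  summable_of_X_pow_dvd fun m => (pow_dvd_pow X (Nat.le_mul_of_pos_left m hc)).mul_right _

theorem eulerSeries_eq_one_add {c : ℕ} (hc : 0 < c) :
    eulerSeries c = 1 + ∑' m : ℕ, X ^ (c * (m + 1)) * (qShifted X X (m + 1))⁻¹ := by
  rw [eulerSeries, (summable_eulerSeries hc).tsum_eq_zero_add]
  simp [qShifted]

theorem one_sub_X_pow_mul_eulerSeries {c : ℕ} (hc : 0 < c) :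
    (1 - X ^ c) * eulerSeries c = eulerSeries (c + 1) := by
  have h1 := (summable_nat_add_iff 1).mpr (summable_eulerSeries hc)
  have h2 := (summable_nat_add_iff 1).mpr (summable_eulerSeries (Nat.add_pos_left hc 1))
  have h3 : eulerSeries c - eulerSeries (c + 1) = X ^ c * eulerSeries c := by
    rw [eulerSeries_eq_one_add hc, eulerSeries_eq_one_add (Nat.add_pos_left hc 1),
      add_sub_add_left_eq_sub,
      ← h1.tsum_sub h2, ← eulerSeries_eq_one_add hc, eulerSeries,
      ← (summable_eulerSeries hc).tsum_mul_left]
    refine tsum_congr fun m => ?_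
    rw [qShifted_X_X_inv_succ m]
    ring
  linear_combination h3

theorem X_pow_dvd_eulerSeries_sub_one {c : ℕ} (hc : 0 < c) : X ^ c ∣ eulerSeries c - 1 := by
  rw [eulerSeries_eq_one_add hc, add_sub_cancel_left]
  exact X_pow_dvd_tsum ((summable_nat_add_iff 1).mpr (summable_eulerSeries hc)) fun m =>
    (pow_dvd_pow X (Nat.le_mul_of_pos_right c m.succ_pos)).mul_right _

/-- Euler's identity `∑ z ^ m / (X; X)_m = 1 / (z; X)_∞` at `z = X ^ c`. -/
theorem qShiftedInf_mul_eulerSeries {c : ℕ} (hc : 0 < c) :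
    qShiftedInf (X ^ c) X * eulerSeries c = 1 := by
  have hfin (N : ℕ) : qShifted (X ^ c) X N * eulerSeries c = eulerSeries (c + N) := by
    induction N with
    | zero => simp [qShifted]
    | succ N ih =>
      rw [qShifted_succ, mul_right_comm, ih, mul_comm, ← pow_add,
        one_sub_X_pow_mul_eulerSeries (by omega), add_assoc]
  refine eq_of_forall_X_pow_dvd_sub fun N => ?_
  have h1 := X_pow_dvd_qShifted_sub_qShiftedInf c N (d := 1) one_pos
  rw [pow_one, one_mul] at h1
  have h2 : qShiftedInf (X ^ c) X * eulerSeries c - 1 = (eulerSeries (c + N) - 1) -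
      (qShifted (X ^ c) X N - qShiftedInf (X ^ c) X) * eulerSeries c := by
    rw [← hfin]; ring
  rw [h2]
  exact dvd_sub ((pow_dvd_pow X (Nat.le_add_left N c)).trans
    (X_pow_dvd_eulerSeries_sub_one (by omega))) (h1.mul_right _)

theorem truncTerm_add (κ m : ℕ) : truncTerm (κ + 1) (κ + 1 + m) =
    X ^ ((κ + 1).choose 2 + (κ + 2) * (κ + 1 + m)) * (qShifted X X (κ + 1 + m))⁻¹ *
      (qShifted X X (κ + m) * ((qShifted X X κ)⁻¹ * (qShifted X X m)⁻¹)) := by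
  rw [truncTerm, show κ + 1 + m - 1 = κ + m by omega, Nat.add_sub_cancel, qBinom,
    if_pos (Nat.le_add_right κ m), Nat.add_sub_cancel_left, PowerSeries.mul_inv_rev,
    mul_comm (qShifted X X m)⁻¹]

theorem truncTerm_succ_add_zero (κ : ℕ) : truncTerm (κ + 2) (κ + 1) = 0 := by
  simp [truncTerm, qBinom]

theorem truncTerm_add_truncTerm_succ (κ m : ℕ) :
    truncTerm (κ + 1) (κ + 1 + m) + truncTerm (κ + 2) (κ + 1 + m) =
      X ^ ((κ + 1).choose 2 + (κ + 2) * (κ + 1)) * (qShifted X X (κ + 1))⁻¹ *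
        (X ^ ((κ + 2) * m) * (qShifted X X m)⁻¹ -
          X ^ ((κ + 2) * m) * X ^ (κ + 1) * ((1 - X ^ m) * (qShifted X X m)⁻¹)) := by
  have h : truncTerm (κ + 2) (κ + 1 + m) =
      X ^ ((κ + 2).choose 2 + (κ + 3) * (κ + 1 + m)) * (qShifted X X (κ + 1 + m))⁻¹ *
      (qShifted X X (κ + m) * ((qShifted X X (κ + 1))⁻¹ * ((1 - X ^ m) *
        (qShifted X X m)⁻¹))) := by
    rcases m with - | m
    · simp [truncTerm_succ_add_zero]
    · rw [← qShifted_X_X_inv_succ, show κ + 1 + (m + 1) = κ + 1 + 1 + m by omega, truncTerm_add,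
        show κ + (m + 1) = κ + 1 + m by omega]
  have h1 : qShifted X X (κ + m) * (1 - X ^ (κ + m + 1)) * (qShifted X X (κ + 1 + m))⁻¹ = 1 := by
    rw [mul_assoc, show κ + 1 + m = κ + m + 1 by omega, ← qShifted_X_X_inv_succ,
      qShifted_X_X_mul_inv]
  have h2 : (κ + 2).choose 2 = κ + 1 + (κ + 1).choose 2 := by
    rw [Nat.choose_succ_succ' (κ + 1) 1, Nat.choose_one_right]
  rw [h, truncTerm_add, h2, qShifted_X_X_inv_succ κ]
  linear_combination X ^ ((κ + 1).choose 2 + (κ + 2) * (κ + 1 + m)) *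
    (qShifted X X (κ + 1))⁻¹ * (qShifted X X m)⁻¹ * (1 - X ^ (κ + 1) + X ^ (κ + 1 + m)) * h1

theorem truncSeries_eq_tsum (k : ℕ) : truncSeries k = ∑' m : ℕ, truncTerm k (k + m) := by
  let e : ℕ ≃ Set.Ici k :=
    { toFun := fun m => ⟨k + m, Nat.le_add_right k m⟩
      invFun := fun n => n - k
      left_inv := fun m => Nat.add_sub_cancel_left k m
      right_inv := fun n => Subtype.ext (Nat.add_sub_cancel' n.2) }
  exact (e.tsum_eq fun n : Set.Ici k => truncTerm k n).symm

theorem X_pow_dvd_truncTerm (k n : ℕ) : X ^ n ∣ truncTerm k n := by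
  rw [truncTerm, mul_assoc]
  exact (pow_dvd_pow X (by nlinarith [Nat.zero_le (k.choose 2), Nat.zero_le (k * n)])).mul_right _

theorem X_pow_dvd_truncSeries (k : ℕ) : X ^ k ∣ truncSeries k :=
  X_pow_dvd_tsum (summable_truncTerm k) fun n =>
    (pow_dvd_pow X n.2).trans (X_pow_dvd_truncTerm k n)

/-- The generalized pentagonal number `j * (3 * j + 1) / 2`, in the form in which it occurs as an
exponent. -/
def pentExp (j : ℕ) : ℕ := j.choose 2 + (j + 1) * j

theorem pentExp_succ (j : ℕ) : pentExp (j + 1) = pentExp j + (3 * j + 2) := by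
  rw [pentExp, pentExp, Nat.choose_succ_succ' j 1, Nat.choose_one_right]
  ring

/-- The recursion of the truncated pentagonal number series: by Pascal's rule for the `q`-binomial
coefficients, the sum of two consecutive series is a multiple of Euler's series. -/
theorem qShiftedInf_mul_truncSeries_add (κ : ℕ) :
    qShiftedInf X X * (truncSeries (κ + 1) + truncSeries (κ + 2)) =
      X ^ pentExp (κ + 1) * (1 - X ^ (2 * κ + 3)) := by
  have hs (k : ℕ) : Summable fun m => truncTerm k (κ + 1 + m) := summable_of_X_pow_dvd fun m =>
    (pow_dvd_pow X (Nat.le_add_left m (κ + 1))).trans (X_pow_dvd_truncTerm k _)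
  have h2 : truncSeries (κ + 2) = ∑' m, truncTerm (κ + 2) (κ + 1 + m) := by
    rw [(hs (κ + 2)).tsum_eq_zero_add, truncSeries_eq_tsum, add_zero, truncTerm_succ_add_zero,
      zero_add]
    exact tsum_congr fun m => congrArg _ (by omega)
  have hV := summable_eulerSeries (c := κ + 2) (by omega)
  have hW : HasSum (fun m : ℕ => (X ^ ((κ + 2) * m) * X ^ (κ + 1) *
      ((1 - X ^ m) * (qShifted X X m)⁻¹) : ℚ⟦X⟧)) (X ^ (2 * κ + 3) * eulerSeries (κ + 2)) := by
    rw [← hasSum_nat_add_iff' 1]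
    simp only [Finset.range_one, Finset.sum_singleton, pow_zero, sub_self, zero_mul, mul_zero,
      sub_zero]
    refine (hV.hasSum.mul_left (X ^ (2 * κ + 3))).congr_fun fun m => ?_
    rw [← qShifted_X_X_inv_succ]
    ring
  have h3 : truncSeries (κ + 1) + truncSeries (κ + 2) = X ^ pentExp (κ + 1) *
      (qShifted X X (κ + 1))⁻¹ * ((1 - X ^ (2 * κ + 3)) * eulerSeries (κ + 2)) := by
    rw [h2, truncSeries_eq_tsum, ← (hs _).tsum_add (hs _)]
    simp only [truncTerm_add_truncTerm_succ]
    rw [(hV.sub hW.summable).tsum_mul_left, hV.tsum_sub hW.summable, hW.tsum_eq, ← eulerSeries,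
      pentExp]
    ring
  have h4 : qShifted X X (κ + 1) * qShiftedInf (X ^ (κ + 2)) X = qShiftedInf X X := by
    rw [← qShifted_mul_qShiftedInf X X (by simp) (κ + 1), ← pow_succ']
  have h5 := qShiftedInf_mul_eulerSeries (c := κ + 2) (by omega)
  rw [h3, ← h4]
  linear_combination X ^ pentExp (κ + 1) * (1 - X ^ (2 * κ + 3)) *
    (qShiftedInf (X ^ (κ + 2)) X * eulerSeries (κ + 2) * qShifted_X_X_mul_inv (κ + 1) + h5)

/-- The truncated pentagonal number series as a sum of terms `pairTerm κ i`, up to a remainder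
that is divisible by high powers of `X`. -/
theorem exists_qShiftedInf_mul_truncSeries (κ I : ℕ) : ∃ r : ℚ⟦X⟧,
    qShiftedInf X X * truncSeries (κ + 1) = ∑ i ∈ Finset.range I,
      X ^ (pentExp (κ + 1 + 2 * i) + 2 * i) * pairTerm κ i + X ^ I * r := by
  have h (I : ℕ) : qShiftedInf X X * truncSeries (κ + 1) = ∑ i ∈ Finset.range I,
      X ^ (pentExp (κ + 1 + 2 * i) + 2 * i) * pairTerm κ i +
      (qShiftedInf X X * truncSeries (κ + 1 + 2 * I) -
        X ^ pentExp (κ + 1 + 2 * I) * (1 - X ^ (2 * I))) := by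
    induction I with
    | zero => simp
    | succ I ih =>
      have h1 := qShiftedInf_mul_truncSeries_add (κ + 2 * I)
      have h2 := qShiftedInf_mul_truncSeries_add (κ + 2 * I + 1)
      rw [show κ + 2 * I + 1 = κ + 1 + 2 * I by ring,
        show κ + 2 * I + 2 = κ + 1 + 2 * I + 1 by ring] at h1
      rw [show κ + 2 * I + 1 + 1 = κ + 1 + 2 * I + 1 by ring,
        show κ + 2 * I + 1 + 2 = κ + 1 + 2 * (I + 1) by ring, pentExp_succ] at h2
      rw [Finset.sum_range_succ, ih, show κ + 1 + 2 * (I + 1) = κ + 1 + 2 * I + 1 + 1 by ring,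
        pentExp_succ, pentExp_succ, pairTerm]
      rw [show κ + 1 + 2 * (I + 1) = κ + 1 + 2 * I + 1 + 1 by ring] at h2
      linear_combination h1 - h2
  have hj : I ≤ pentExp (κ + 1 + 2 * I) := by
    unfold pentExp
    nlinarith [Nat.zero_le ((κ + 1 + 2 * I).choose 2)]
  obtain ⟨r, hr⟩ := (pow_dvd_pow X (show I ≤ κ + 1 + 2 * I by omega)).trans
    (X_pow_dvd_truncSeries (κ + 1 + 2 * I))
  obtain ⟨s, hs⟩ := pow_dvd_pow (X : ℚ⟦X⟧) hj
  refine ⟨qShiftedInf X X * r - s * (1 - X ^ (2 * I)), ?_⟩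
  rw [h I, hr, hs]
  ring

/-! ### Nonnegativity of the coefficients -/

/-- If `A` is `(X; X)_∞` without the factors in two residue classes, then `A * S_k` is the sum of
the quotients of the terms `pairTerm κ i` by these factors, of which only finitely many
matter for any given coefficient. -/
theorem coeff_mul_truncSeries {A : ℚ⟦X⟧} {r s : ℕ} (hr : r < 5) (hs : s < 5) (hr0 : r ≠ 0)
    (hs0 : s ≠ 0) (hrs : r ≠ s)
    (hA : qShiftedInf (X ^ r) (X ^ 5) * qShiftedInf (X ^ s) (X ^ 5) * A = qShiftedInf X X)
    (κ : ℕ) {m N : ℕ} (hN : m < N) : coeff m (A * truncSeries (κ + 1)) =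
      ∑ i ∈ Finset.range N, coeff m (X ^ (pentExp (κ + 1 + 2 * i) + 2 * i) *
        (pairTerm κ i * partGen (partsMod r s N))) := by
  obtain ⟨f, hf⟩ := exists_qShiftedInf_mul_truncSeries κ N
  have h0 : 0 ∉ partsMod r s N := by
    simp only [partsMod, Finset.mem_filter]
    omega
  have h1 := prod_mul_partGen h0
  rw [prod_partsMod hr hs hrs] at h1
  have hd (c : ℕ) : X ^ N ∣ qShifted (X ^ c) (X ^ 5) N - qShiftedInf (X ^ c) (X ^ 5) :=
    (pow_dvd_pow X (by omega)).trans (X_pow_dvd_qShifted_sub_qShiftedInf c N (by norm_num))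
  obtain ⟨u, hu⟩ := hd r
  obtain ⟨v, hv⟩ := hd s
  have h2 : A * truncSeries (κ + 1) = ∑ i ∈ Finset.range N,
      X ^ (pentExp (κ + 1 + 2 * i) + 2 * i) * (pairTerm κ i * partGen (partsMod r s N)) +
      X ^ N * (f * partGen (partsMod r s N) + (u * qShifted (X ^ s) (X ^ 5) N +
        v * qShiftedInf (X ^ r) (X ^ 5)) * (A * truncSeries (κ + 1)) *
          partGen (partsMod r s N)) := by
    simp only [← mul_assoc]
    rw [← Finset.sum_mul]
    rw [← hA] at hf
    linear_combination partGen (partsMod r s N) * hf - A * truncSeries (κ + 1) * h1 +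
      A * truncSeries (κ + 1) * partGen (partsMod r s N) *
        (qShifted (X ^ s) (X ^ 5) N * hu + qShiftedInf (X ^ r) (X ^ 5) * hv)
  rw [h2, map_add, coeff_X_pow_mul', if_neg (by omega), add_zero, map_sum]

theorem subset_partsMod {P : Finset ℕ} {r s N : ℕ} (hN : 6 ≤ N)
    (h : ∀ p ∈ P, p < 30 ∧ (p % 5 = r ∨ p % 5 = s)) : P ⊆ partsMod r s N := fun p hp => by
  have := h p hp
  simp only [partsMod, Finset.mem_filter, Finset.mem_range]
  omega

theorem coeffNonneg_pairTerm_mul_partGen_one_four (κ i : ℕ) {N : ℕ} (hN : 6 ≤ N) :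
    CoeffNonneg (pairTerm κ i * partGen (partsMod 1 4 N)) := by
  suffices h : PosOver {1, 4, 6, 9, 11, 14, 16, 19} (pairTerm κ i) from
    h.mono (subset_partsMod hN (by decide))
  obtain rfl | rfl | hκ : κ = 0 ∨ κ = 1 ∨ 2 ≤ κ := by omega
  · obtain rfl | hi := Nat.eq_zero_or_pos i
    · exact pairTerm_zero_zero_posOver.mono (by decide)
    · exact (pairTerm_zero_posOver hi).mono (by decide)
  · obtain rfl | hi := Nat.eq_zero_or_pos i
    · exact pairTerm_one_zero_posOver.mono (by decide)
    · exact (pairTerm_one_posOver hi).mono (by decide)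
  · by_cases h : κ = 2 ∧ i = 0
    · obtain ⟨rfl, rfl⟩ := h
      exact pairTerm_two_zero_posOver.mono (by decide)
    · exact (pairTerm_posOver_of_two_le hκ (by omega)).mono (by decide)

theorem coeffNonneg_pairTerm_mul_partGen_two_three {κ i N : ℕ} (h : κ ≠ 0 ∨ i ≠ 0) (hN : 6 ≤ N) :
    CoeffNonneg (pairTerm κ i * partGen (partsMod 2 3 N)) := by
  suffices h : PosOver {2, 3, 7, 8, 12, 13, 17, 18, 22, 23, 27} (pairTerm κ i) from
    h.mono (subset_partsMod hN (by decide))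
  obtain rfl | hκ := Nat.eq_zero_or_pos κ
  · exact (pairTerm_zero_posOver_two_three (by omega)).mono (by decide)
  · exact pairTerm_posOver_of_one_le hκ

/-- Only `pairTerm 0 0` contributes negative coefficients. -/
theorem coeff_mul_truncSeries_one (m : ℕ) : ∃ c : ℚ, 0 ≤ c ∧ (m < 17 → c = 0) ∧
    coeff m (qShiftedInf X (X ^ 5) * qShiftedInf (X ^ 4) (X ^ 5) * qShiftedInf (X ^ 5) (X ^ 5) *
      truncSeries 1) = (if 2 ≤ m then
        coeff (m - 2) (pairTerm 0 0 * partGen (partsMod 2 3 (m + 6))) else 0) + c := by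
  have hA : qShiftedInf (X ^ 2) (X ^ 5) * qShiftedInf (X ^ 3) (X ^ 5) *
      (qShiftedInf X (X ^ 5) * qShiftedInf (X ^ 4) (X ^ 5) * qShiftedInf (X ^ 5) (X ^ 5)) =
      qShiftedInf X X := by
    rw [qShiftedInf_X_X]; ring
  refine ⟨_, ?_, ?_, (coeff_mul_truncSeries (by norm_num) (by norm_num) (by norm_num)
    (by norm_num) (by norm_num) hA 0 (show m < m + 6 by omega)).trans
    ((Finset.sum_range_succ' _ _).trans ((add_comm _ _).trans
      (congrArg (· + _) (coeff_X_pow_mul' _ _ _))))⟩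
  · exact Finset.sum_nonneg fun i _ => (CoeffNonneg.X_pow _).mul
      (coeffNonneg_pairTerm_mul_partGen_two_three (Or.inr i.succ_ne_zero) (by omega)) m
  · intro hm
    refine Finset.sum_eq_zero fun i _ => ?_
    rw [coeff_X_pow_mul', if_neg]
    unfold pentExp
    nlinarith [Nat.choose_le_choose 2 (show 3 ≤ 0 + 1 + 2 * (i + 1) by omega),
      show Nat.choose 3 2 = 3 by rfl]

theorem mainTheorem6 :
    (∀ k : ℕ, 0 < k → ∀ m : ℕ, 0 ≤ coeff m
      (qShiftedInf (X ^ 2) (X ^ 5) * qShiftedInf (X ^ 3) (X ^ 5) * qShiftedInf (X ^ 5) (X ^ 5) *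
        truncSeries k)) ∧
    (∀ k : ℕ, 1 < k → ∀ m : ℕ, 0 ≤ coeff m
      (qShiftedInf X (X ^ 5) * qShiftedInf (X ^ 4) (X ^ 5) * qShiftedInf (X ^ 5) (X ^ 5) *
        truncSeries k)) ∧
    coeff 7
      (qShiftedInf X (X ^ 5) * qShiftedInf (X ^ 4) (X ^ 5) * qShiftedInf (X ^ 5) (X ^ 5) *
        truncSeries 1) = -1 ∧
    coeff 13
      (qShiftedInf X (X ^ 5) * qShiftedInf (X ^ 4) (X ^ 5) * qShiftedInf (X ^ 5) (X ^ 5) *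
        truncSeries 1) = -1 ∧
    (∀ m : ℕ, m ≠ 7 → m ≠ 13 → 0 ≤ coeff m
      (qShiftedInf X (X ^ 5) * qShiftedInf (X ^ 4) (X ^ 5) * qShiftedInf (X ^ 5) (X ^ 5) *
        truncSeries 1)) := by

  have hP (N : ℕ) : {2, 3, 7, 8, 13, 17} ⊆ partsMod 2 3 (N + 6) :=
    subset_partsMod (by omega) (by decide)
  have hmod (N : ℕ) : ∀ p ∈ partsMod 2 3 N, p % 5 = 2 ∨ p % 5 = 3 := fun p hp =>
    (Finset.mem_filter.mp hp).2
  refine ⟨fun k hk m => ?_, fun k hk m => ?_, ?_, ?_, fun m h7 h13 => ?_⟩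
  · obtain ⟨κ, rfl⟩ : ∃ κ, k = κ + 1 := ⟨k - 1, by omega⟩
    rw [coeff_mul_truncSeries (r := 1) (s := 4) (by norm_num) (by norm_num) (by norm_num)
      (by norm_num) (by norm_num) (by rw [pow_one, ← qShiftedInf_X_X]) κ
      (show m < m + 6 by omega)]
    exact Finset.sum_nonneg fun i _ => (CoeffNonneg.X_pow _).mul
      (coeffNonneg_pairTerm_mul_partGen_one_four κ i (by omega)) m
  · obtain ⟨κ, rfl⟩ : ∃ κ, k = κ + 1 := ⟨k - 1, by omega⟩
    rw [coeff_mul_truncSeries (r := 2) (s := 3) (by norm_num) (by norm_num) (by norm_num)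
      (by norm_num) (by norm_num) (by rw [qShiftedInf_X_X]; ring) κ
      (show m < m + 6 by omega)]
    exact Finset.sum_nonneg fun i _ => (CoeffNonneg.X_pow _).mul
      (coeffNonneg_pairTerm_mul_partGen_two_three (by omega) (by omega)) m
  · obtain ⟨c, -, hc, h⟩ := coeff_mul_truncSeries_one 7
    rw [h, hc (by norm_num), if_pos (by norm_num),
      coeff_pairTerm_zero_zero (hP 7) (hmod _) (by norm_num)]
    norm_num [firstCoeffs]
  · obtain ⟨c, -, hc, h⟩ := coeff_mul_truncSeries_one 13
    rw [h, hc (by norm_num), if_pos (by norm_num),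
      coeff_pairTerm_zero_zero (hP 13) (hmod _) (by norm_num)]
    norm_num [firstCoeffs]
  · obtain ⟨c, h0, -, h⟩ := coeff_mul_truncSeries_one m
    rw [h]
    refine add_nonneg ?_ h0
    split_ifs with hm
    · have h1 := coeffNonneg_pairTerm_zero_zero_add (hP m) (hmod _) (m - 2)
      rwa [map_add, map_add, coeff_X_pow, coeff_X_pow, if_neg (by omega), if_neg (by omega),
        add_zero, add_zero] at h1
    · exact le_rfl
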